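/- Let $r\ge 1$, $0\le p<n$ be integers and $\nu>0$. Let $\mathcal K_\nu$ be the modified Bessel function of the second kind, and let $k_\nu(0)=1$ and $$k_\nu(d)=\frac{1}{\Gamma(\nu)2^{\nu-1}}\,(2\sqrt\nu\, d)^\nu\,\mathcal K_\nu(2\sqrt\nu\, d)\qquad(d>0).$$ Let $K:\mathbb R^r\to\mathbb R$ be either the Matérn isotropic kernel $K(x)=k_\nu(\|x\|)$ ($\|\cdot\|$ the Euclidean norm; it yields the anisotropic geometric Matérn correlation kernels) or the tensorized Matérn kernel $K(x)=\prod_{j=1}^r k_\nu(|x_j|)$. Let $x^{(1)},\dots,x^{(n)}\in\mathbb R^r$ be coordinate-distinct design points, that is, $x^{(a)}_j\ne x^{(b)}_j$ for all $a\neq b$ and all $j$. For $\mu\in[0,+\infty)^r$ (inverse correlation lengths) let $\Sigma_\mu$ be the $n\times n$ matrix with entries $$(\Sigma_\mu)_{ab}=K\big((x^{(a)}_1-x^{(b)}_1)\mu_1,\dots,(x^{(a)}_r-x^{(b)}_r)\mu_r\big).$$ Let $H$ be the $n\times p$ matrix, assumed of rank $p$, whose columns contain the values at the design points of the $p$ basis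 functions of the mean function space, and let $W$ be an $n\times(n-p)$ matrix of rank $n-p$ with $W^\top H=0$. For $i\in\{1,\dots,r\}$ the unnormalized conditional reference prior is $$f_i(\mu_i\mid\mu_{-i})=\sqrt{\operatorname{Tr}\!\left[B^2\right]-\frac1{n-p}\operatorname{Tr}[B]^2},\qquad B=W^\top\frac{\partial\Sigma_\mu}{\partial\mu_i}W\,\big(W^\top\Sigma_\mu W\big)^{-1}.$$ Then, for every $i$ and every $\mu\in[0,+\infty)^r$ with $\mu_i>0$, the quantity $f_i(\mu_i\mid\mu_{-i})$ is well defined (the entries of $\Sigma_\mu$ are differentiable with respect to $\mu_i$ at $\mu$, $W^\top\Sigma_\mu W$ is invertible, and the expression under the square root is nonnegative), and $$f_i(\mu_i\mid\mu_{-i})\le (n-p)(2\nu+r)\,\mu_i^{-1}.$$ -/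

import Mathlib

namespace Kriging

noncomputable section

/-- The modified Bessel function of the second kind `𝒦_ν(z)`, for `z > 0`:
`𝒦_ν(z) = ∫₀^∞ exp(-z cosh t) cosh(ν t) dt`. -/
def besselK (ν z : ℝ) : ℝ :=
  ∫ t in Set.Ioi (0 : ℝ), Real.exp (-z * Real.cosh t) * Real.cosh (ν * t)

/-- The radial profile of the Matérn correlation kernel with smoothness `ν` and correlation
length `1`, as a function of the distance `d ≥ 0`. At `d = 0` the formula
`(2√ν d)^ν 𝒦_ν(2√ν d) / (Γ(ν) 2^(ν-1))` has the limit `1`, which is its value there. -/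
def maternProfile (ν d : ℝ) : ℝ :=
  if d = 0 then 1
  else 1 / (Real.Gamma ν * (2 : ℝ) ^ (ν - 1)) * (2 * Real.sqrt ν * d) ^ ν *
    besselK ν (2 * Real.sqrt ν * d)

/-- The `r`-dimensional Matérn isotropic kernel `K_{r,ν}`
(variance `1`, correlation length `1`, smoothness `ν`). -/
def maternIsotropic (r : ℕ) (ν : ℝ) (x : EuclideanSpace ℝ (Fin r)) : ℝ :=
  maternProfile ν ‖x‖

/-- The `r`-dimensional Matérn tensorized kernel `K_{r,ν}^{tens}(x) = ∏_j K_{1,ν}(x_j)`. -/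
def maternTensorized (r : ℕ) (ν : ℝ) (x : EuclideanSpace ℝ (Fin r)) : ℝ :=
  ∏ j, maternProfile ν |x j|

/-- The coordinatewise product `t μ = (t_1 μ_1, …, t_r μ_r)`. -/
def scale {r : ℕ} (t : EuclideanSpace ℝ (Fin r)) (μ : Fin r → ℝ) : EuclideanSpace ℝ (Fin r) :=
  WithLp.toLp 2 (fun j => t j * μ j)

/-- A design set is coordinate-distinct if, along each coordinate axis, any two of its points
have different coordinates. -/
def CoordinateDistinct {n r : ℕ} (x : Fin n → EuclideanSpace ℝ (Fin r)) : Prop :=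
  ∀ a b : Fin n, a ≠ b → ∀ j : Fin r, x a j ≠ x b j

/-- The correlation matrix `Σ_μ` of the design set `x`, for the autocorrelation function
`t ↦ K(t μ)` with inverse correlation lengths `μ`. -/
def corrMatrix {n r : ℕ} (K : EuclideanSpace ℝ (Fin r) → ℝ)
    (x : Fin n → EuclideanSpace ℝ (Fin r)) (μ : Fin r → ℝ) : Matrix (Fin n) (Fin n) ℝ :=
  Matrix.of fun a b => K (scale (x a - x b) μ)

/-- The entrywise partial derivative `∂Σ_μ / ∂μ_i`. -/
def corrMatrixDeriv {n r : ℕ} (K : EuclideanSpace ℝ (Fin r) → ℝ)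
    (x : Fin n → EuclideanSpace ℝ (Fin r)) (i : Fin r) (μ : Fin r → ℝ) :
    Matrix (Fin n) (Fin n) ℝ :=
  Matrix.of fun a b => deriv (fun t => corrMatrix K x (Function.update μ i t) a b) (μ i)

/-- The matrix `H` whose columns contain the values of the basis functions `h_1, …, h_p` of the
mean function space at the points of the design set. -/
def regressionMatrix {n p r : ℕ} (h : Fin p → EuclideanSpace ℝ (Fin r) → ℝ)
    (x : Fin n → EuclideanSpace ℝ (Fin r)) : Matrix (Fin n) (Fin p) ℝ :=
  Matrix.of fun a k => h k (x a)

/-- The matrix `Wᵀ (∂Σ_μ / ∂μ_i) W (Wᵀ Σ_μ W)⁻¹`. -/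
def priorMatrix {n m r : ℕ} (K : EuclideanSpace ℝ (Fin r) → ℝ)
    (x : Fin n → EuclideanSpace ℝ (Fin r)) (W : Matrix (Fin n) (Fin m) ℝ)
    (i : Fin r) (μ : Fin r → ℝ) : Matrix (Fin m) (Fin m) ℝ :=
  W.transpose * corrMatrixDeriv K x i μ * W * (W.transpose * corrMatrix K x μ * W)⁻¹

/-- The quantity under the square root in the unnormalized conditional reference prior:
`Tr[B²] - Tr[B]² / m`, with `B = Wᵀ (∂Σ_μ / ∂μ_i) W (Wᵀ Σ_μ W)⁻¹` and `m` the number of columns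
of `W` (which is `n - p` in Universal Kriging). -/
def priorRadicand {n m r : ℕ} (K : EuclideanSpace ℝ (Fin r) → ℝ)
    (x : Fin n → EuclideanSpace ℝ (Fin r)) (W : Matrix (Fin n) (Fin m) ℝ)
    (i : Fin r) (μ : Fin r → ℝ) : ℝ :=
  ((priorMatrix K x W i μ) ^ 2).trace - 1 / (m : ℝ) * (priorMatrix K x W i μ).trace ^ 2

/-- The unnormalized conditional reference prior `f_i(μ_i | μ_{-i})`. -/
def refPrior {n m r : ℕ} (K : EuclideanSpace ℝ (Fin r) → ℝ)
    (x : Fin n → EuclideanSpace ℝ (Fin r)) (W : Matrix (Fin n) (Fin m) ℝ)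
    (i : Fin r) (μ : Fin r → ℝ) : ℝ :=
  Real.sqrt (priorRadicand K x W i μ)

end

end Kriging

open MeasureTheory Set Matrix
open scoped MatrixOrder

namespace Kriging

/-! ### Loewner order: Hadamard products and matrix-valued integrals. -/

section Loewner

variable {ι : Type*}

/-! Everything reduces to the Loewner bounds `-μ_i⁻¹ Σ ≤ ∂Σ/∂μ_i ≤ (2ν + r - 1) μ_i⁻¹ Σ`
(`corrMatrix_loewner_bounds`). Congruence by `W` preserves them, so `B` is similar to a symmetric
matrix with spectrum in an interval of width `(2ν + r) μ_i⁻¹`. The radicand is `n - p` times the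
variance of the eigenvalues, hence at most `n - p` times the squared width (`trace_mul_inv_bounds`).

The two bounds are differentiated monotonicity statements in `t = μ_i`: `t Σ` is nondecreasing and
`t^(-k) Σ` nonincreasing for some `k ≤ 2ν + r - 1` (`loewner_deriv_bounds`). Both come from writing
the Matérn profile as a Gamma mixture of Gaussians (`maternProfile_eq_integral`). For one Gaussian
factor, `c exp(-s c² y²)` is a Fourier integral whose weight increases with `c`
(`smul_gaussMatrix_mono`), which gives the first monotonicity after Hadamard products and mixing.
For the second, substituting `u = t² v` in the mixture freezes coordinate `i` and moves `t⁻¹` into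
the other coordinates, where the same lemma applies with the order reversed
(`rescaledIntegrand_antitone`). Hadamard products preserve all these inequalities by Schur's
theorem. -/

theorem hadamard_le_hadamard {A B C D : Matrix ι ι ℝ} (hA : 0 ≤ A) (hAB : A ≤ B) (hC : 0 ≤ C)
    (hCD : C ≤ D) : A ⊙ C ≤ B ⊙ D := by
  have h1 : (B - A).PosSemidef := hAB
  have h2 : (D - C).PosSemidef := hCD
  have hD : D.PosSemidef := (hC.trans hCD).posSemidef
  have : B ⊙ D - A ⊙ C = (B - A) ⊙ D + A ⊙ (D - C) := by
    ext a b
    simp only [Matrix.sub_apply, Matrix.add_apply, hadamard_apply]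
    ring
  rw [le_iff, this]
  exact (h1.hadamard hD).add (hA.posSemidef.hadamard h2)

theorem of_mul_self_nonneg [Finite ι] (v : ι → ℝ) :
    (0 : Matrix ι ι ℝ) ≤ Matrix.of fun a b => v a * v b := by
  have := Fintype.ofFinite ι
  exact (Matrix.posSemidef_vecMulVec_self_star v).nonneg

theorem prod_hadamard_le [Finite ι] {κ : Type*} (J : Finset κ) {A B : κ → Matrix ι ι ℝ}
    (hA : ∀ j ∈ J, 0 ≤ A j) (hAB : ∀ j ∈ J, A j ≤ B j) :
    (0 : Matrix ι ι ℝ) ≤ Matrix.of (fun a b => ∏ j ∈ J, A j a b) ∧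
      Matrix.of (fun a b => ∏ j ∈ J, A j a b) ≤ Matrix.of (fun a b => ∏ j ∈ J, B j a b) := by
  classical
  induction J using Finset.induction_on with
  | empty => simpa using of_mul_self_nonneg (fun _ : ι => (1 : ℝ))
  | insert k J hk ih =>
    obtain ⟨h0, hle⟩ := ih (fun j hj => hA j (Finset.mem_insert_of_mem hj))
      (fun j hj => hAB j (Finset.mem_insert_of_mem hj))
    have hAk := hA k (Finset.mem_insert_self k J)
    have hABk := hAB k (Finset.mem_insert_self k J)
    have e : ∀ C : κ → Matrix ι ι ℝ, Matrix.of (fun a b => ∏ j ∈ insert k J, C j a b) =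
        C k ⊙ Matrix.of (fun a b => ∏ j ∈ J, C j a b) := by
      intro C
      ext a b
      simp [hadamard_apply, Finset.prod_insert hk]
    rw [e A, e B]
    exact ⟨(hAk.posSemidef.hadamard h0.posSemidef).nonneg, hadamard_le_hadamard hAk hABk h0 hle⟩

variable [Fintype ι]

theorem smul_one_le_of_posDef [DecidableEq ι] {A : Matrix ι ι ℝ} (hA : A.PosDef) :
    ∃ ε : ℝ, 0 < ε ∧ ε • (1 : Matrix ι ι ℝ) ≤ A := by
  cases isEmpty_or_nonempty ι
  · exact ⟨1, one_pos, (Subsingleton.elim _ _).le⟩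
  have h := (CFC.exists_pos_algebraMap_le_iff (a := A) (hA.isHermitian)).2
  have h2 : ∀ x ∈ spectrum ℝ A, 0 < x := by
    rw [hA.isHermitian.spectrum_real_eq_range_eigenvalues]
    rintro _ ⟨k, rfl⟩
    exact hA.eigenvalues_pos k
  obtain ⟨r, hr, h3⟩ := h h2
  exact ⟨r, hr, by simpa [Algebra.algebraMap_eq_smul_one] using h3⟩

/-- Since `A ≥ ε • 1`, the Hadamard product dominates `ε` times the diagonal of `P`. -/
theorem posDef_hadamard_of_diag_pos {A P : Matrix ι ι ℝ} (hA : A.PosDef) (hP : P.PosSemidef)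
    (hd : ∀ a, 0 < P a a) : (A ⊙ P).PosDef := by
  classical
  obtain ⟨ε, hε, h⟩ := smul_one_le_of_posDef hA
  have h1 : (A - ε • (1 : Matrix ι ι ℝ)).PosSemidef := h
  have e : A ⊙ P = (A - ε • (1 : Matrix ι ι ℝ)) ⊙ P + Matrix.diagonal fun a => ε * P a a := by
    ext a b
    by_cases hab : a = b
    · subst hab
      simp
      ring
    · simp [hab]
  rw [e]
  exact Matrix.PosDef.posSemidef_add (h1.hadamard hP)
    (Matrix.PosDef.diagonal fun a => mul_pos hε (hd a))

theorem dotProduct_mulVec_eq_sum (M : Matrix ι ι ℝ) (w : ι → ℝ) :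
    star w ⬝ᵥ (M *ᵥ w) = ∑ a, ∑ b, w a * (M a b * w b) := by
  simp [dotProduct, mulVec, Finset.mul_sum]

section Integral

variable {Ω : Type*} [MeasurableSpace Ω] {m : Measure Ω} {F G : Ω → Matrix ι ι ℝ}

theorem dotProduct_mulVec_integral (hF : ∀ a b, Integrable (fun ω => F ω a b) m) (w : ι → ℝ) :
    Integrable (fun ω => star w ⬝ᵥ (F ω *ᵥ w)) m ∧
    star w ⬝ᵥ ((Matrix.of fun a b => ∫ ω, F ω a b ∂m) *ᵥ w) =
      ∫ ω, star w ⬝ᵥ (F ω *ᵥ w) ∂m := by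
  have hi : ∀ a b, Integrable (fun ω => w a * (F ω a b * w b)) m := fun a b =>
    ((hF a b).mul_const _).const_mul _
  simp only [dotProduct_mulVec_eq_sum]
  refine ⟨integrable_finsetSum _ fun a _ => integrable_finsetSum _ fun b _ => hi a b, ?_⟩
  rw [integral_finsetSum _ fun a _ => integrable_finsetSum _ fun b _ => hi a b]
  refine Finset.sum_congr rfl fun a _ => ?_
  rw [integral_finsetSum _ fun b _ => hi a b]
  refine Finset.sum_congr rfl fun b _ => ?_
  rw [integral_const_mul, integral_mul_const, Matrix.of_apply]

omit [Fintype ι] in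
theorem isHermitian_integral (h : ∀ᵐ ω ∂m, (F ω).IsHermitian) :
    (Matrix.of fun a b => ∫ ω, F ω a b ∂m).IsHermitian := by
  ext a b
  simp only [conjTranspose_apply, Matrix.of_apply, star_trivial]
  refine integral_congr_ae ?_
  filter_upwards [h] with ω hω
  simpa using hω.apply a b

theorem integral_mono_loewner (hF : ∀ a b, Integrable (fun ω => F ω a b) m)
    (hG : ∀ a b, Integrable (fun ω => G ω a b) m) (h : ∀ᵐ ω ∂m, F ω ≤ G ω) :
    (Matrix.of fun a b => ∫ ω, F ω a b ∂m) ≤ Matrix.of fun a b => ∫ ω, G ω a b ∂m := by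
  have e : (Matrix.of fun a b => ∫ ω, G ω a b ∂m) - (Matrix.of fun a b => ∫ ω, F ω a b ∂m) =
      Matrix.of fun a b => ∫ ω, (G ω - F ω) a b ∂m := by
    ext a b
    simp only [Matrix.sub_apply, Matrix.of_apply]
    exact (integral_sub (hG a b) (hF a b)).symm
  rw [le_iff, e]
  have hGF : ∀ a b, Integrable (fun ω => (G ω - F ω) a b) m := fun a b => (hG a b).sub (hF a b)
  refine Matrix.PosSemidef.of_dotProduct_mulVec_nonneg
    (isHermitian_integral (h.mono fun ω hω => (show (G ω - F ω).PosSemidef from hω).1)) fun w => ?_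
  rw [(dotProduct_mulVec_integral hGF w).2]
  refine integral_nonneg_of_ae (h.mono fun ω hω => ?_)
  exact (show (G ω - F ω).PosSemidef from hω).dotProduct_mulVec_nonneg w

theorem posDef_integral (hm : m ≠ 0) (hF : ∀ a b, Integrable (fun ω => F ω a b) m)
    (h : ∀ᵐ ω ∂m, (F ω).PosDef) : (Matrix.of fun a b => ∫ ω, F ω a b ∂m).PosDef := by
  refine Matrix.PosDef.of_dotProduct_mulVec_pos (isHermitian_integral (h.mono fun ω hω => hω.1))
    fun w hw => ?_
  obtain ⟨hi, he⟩ := dotProduct_mulVec_integral hF w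
  rw [he]
  have hpos : ∀ᵐ ω ∂m, 0 < star w ⬝ᵥ (F ω *ᵥ w) := h.mono fun ω hω => hω.dotProduct_mulVec_pos hw
  have hnn : 0 ≤ᵐ[m] fun ω => star w ⬝ᵥ (F ω *ᵥ w) := hpos.mono fun ω hω => hω.le
  refine (integral_nonneg_of_ae hnn).lt_of_ne' fun h0 => hm ?_
  rw [integral_eq_zero_iff_of_nonneg_ae hnn hi] at h0
  have : ∀ᵐ ω ∂m, False := by
    filter_upwards [hpos, h0] with ω h1 h2
    simp only [Pi.zero_apply] at h2
    linarith
  simpa using this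

end Integral

end Loewner

/-! ### Gaussian correlation matrices and their Fourier representation. -/

section Gaussian

variable {ι : Type*}

/-- The Gaussian correlation matrix `exp(-s (y_a - y_b)²)` of the points `y`. -/
noncomputable def gaussMatrix (s : ℝ) (y : ι → ℝ) : Matrix ι ι ℝ :=
  Matrix.of fun a b => Real.exp (-s * (y a - y b) ^ 2)

theorem integral_exp_mul_cos {b : ℝ} (hb : 0 < b) (t : ℝ) :
    ∫ x : ℝ, Real.exp (-b * x ^ 2) * Real.cos (t * x) =
      Real.sqrt (Real.pi / b) * Real.exp (-t ^ 2 / (4 * b)) := by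
  have h := fourierIntegral_gaussian (b := (b : ℂ)) (by simpa using hb) (t : ℂ)
  have h2 : ∫ x : ℝ, Real.exp (-b * x ^ 2) * Real.cos (t * x) = 
      (∫ x : ℝ, Complex.exp (Complex.I * t * x) * Complex.exp (-b * x ^ 2)).re := by
    have hint : Integrable fun x : ℝ =>
        Complex.exp (Complex.I * t * x) * Complex.exp (-b * x ^ 2) := by
      have := integrable_cexp_quadratic (b := (b : ℂ)) (by simpa using hb) (Complex.I * t) 0
      refine this.congr (.of_forall fun x => ?_)
      dsimp only
      rw [← Complex.exp_add]
      congr 1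
      ring
    rw [← RCLike.re_eq_complex_re, ← integral_re hint]
    refine integral_congr_ae (.of_forall fun x => ?_)
    have e1 : Complex.I * t * x = ((t * x : ℝ) : ℂ) * Complex.I := by push_cast; ring
    have e2 : -(b : ℂ) * x ^ 2 = ((-b * x ^ 2 : ℝ) : ℂ) := by push_cast; ring
    simp only [RCLike.re_eq_complex_re]
    rw [e1, e2, ← Complex.ofReal_exp, Complex.re_mul_ofReal, Complex.exp_ofReal_mul_I_re, mul_comm]
  rw [h2, h]
  have e1 : ((Real.pi : ℂ) / b) ^ (1 / 2 : ℂ) = ((Real.sqrt (Real.pi / b) : ℝ) : ℂ) := by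
    rw [Real.sqrt_eq_rpow, Complex.ofReal_cpow (by positivity)]
    push_cast
    rfl
  have e2 : -(t : ℂ) ^ 2 / (4 * b) = ((-t ^ 2 / (4 * b) : ℝ) : ℂ) := by push_cast; ring
  rw [e1, e2, ← Complex.ofReal_exp, ← Complex.ofReal_mul, Complex.ofReal_re]

theorem integrable_exp_mul_cos {b : ℝ} (hb : 0 < b) (t : ℝ) :
    Integrable fun x : ℝ => Real.exp (-b * x ^ 2) * Real.cos (t * x) := by
  refine (integrable_exp_neg_mul_sq hb).mul_bdd (c := 1) (by fun_prop) (.of_forall fun x => ?_)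
  simpa using Real.abs_cos_le_one _

variable [Fintype ι]

theorem cosMatrix_nonneg (y : ι → ℝ) (x : ℝ) :
    (0 : Matrix ι ι ℝ) ≤ Matrix.of fun a b => Real.cos ((y a - y b) * x) := by
  have e : (Matrix.of fun a b => Real.cos ((y a - y b) * x)) =
      Matrix.of (fun a b => Real.cos (y a * x) * Real.cos (y b * x)) +
      Matrix.of (fun a b => Real.sin (y a * x) * Real.sin (y b * x)) := by
    ext a b
    simp [sub_mul, Real.cos_sub]
  rw [e]
  exact add_nonneg (of_mul_self_nonneg _) (of_mul_self_nonneg _)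

/-- Expanding `exp(2 s y_a y_b)` in its power series turns the quadratic form into a positive
combination of squared moments `v k`. -/
theorem gaussMatrix_posDef {n : ℕ} {s : ℝ} (hs : 0 < s) {y : Fin n → ℝ}
    (hy : Function.Injective y) : (gaussMatrix s y).PosDef := by
  refine Matrix.PosDef.of_dotProduct_mulVec_pos ?_ fun w hw => ?_
  · ext a b
    simp only [gaussMatrix, conjTranspose_apply, Matrix.of_apply, star_trivial]
    congr 2
    ring
  rw [dotProduct_mulVec_eq_sum]
  set v : ℕ → ℝ := fun k => ∑ a, (w a * Real.exp (-s * y a ^ 2)) * y a ^ k with hv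
  have hsum : HasSum (fun k : ℕ => (2 * s) ^ k / k.factorial * v k ^ 2)
      (∑ a, ∑ b, w a * (gaussMatrix s y a b * w b)) := by
    have hab : ∀ a b, HasSum (fun k : ℕ => (2 * s) ^ k / k.factorial *
        ((w a * Real.exp (-s * y a ^ 2)) * y a ^ k * ((w b * Real.exp (-s * y b ^ 2)) * y b ^ k)))
        (w a * (gaussMatrix s y a b * w b)) := by
      intro a b
      have h := (NormedSpace.expSeries_div_hasSum_exp (𝔸 := ℝ) (2 * s * y a * y b)).mul_left
        (w a * Real.exp (-s * y a ^ 2) * (w b * Real.exp (-s * y b ^ 2)))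
      rw [← Real.exp_eq_exp_ℝ] at h
      have e : w a * (gaussMatrix s y a b * w b) = w a * Real.exp (-s * y a ^ 2) *
          (w b * Real.exp (-s * y b ^ 2)) * Real.exp (2 * s * y a * y b) := by
        have : Real.exp (-s * (y a - y b) ^ 2) = Real.exp (-s * y a ^ 2) *
            Real.exp (-s * y b ^ 2) * Real.exp (2 * s * y a * y b) := by
          rw [← Real.exp_add, ← Real.exp_add]
          congr 1
          ring
        simp only [gaussMatrix, Matrix.of_apply, this]
        ring
      rw [e]
      refine h.congr_fun fun k => ?_
      rw [mul_pow, mul_pow]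
      ring
    have h := hasSum_sum (s := Finset.univ) fun a _ => hasSum_sum (s := Finset.univ) fun b _ =>
      hab a b
    refine h.congr_fun fun k => ?_
    rw [sq, hv, Finset.sum_mul_sum, Finset.mul_sum]
    exact Finset.sum_congr rfl fun a _ => by rw [Finset.mul_sum]
  have hnn : ∀ k, 0 ≤ (2 * s) ^ k / k.factorial * v k ^ 2 := fun k => by positivity
  -- Vandermonde: at distinct nodes, vanishing moments force the coefficients to vanish.
  obtain ⟨k, hk⟩ : ∃ k, v k ≠ 0 := by
    by_contra! h0
    have := Matrix.eq_zero_of_forall_pow_sum_mul_pow_eq_zero hy (fun k => h0 k)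
    refine hw (funext fun a => ?_)
    have ha := congrFun this a
    simpa using ha
  rw [← hsum.tsum_eq]
  exact hsum.summable.tsum_pos hnn k (by positivity)

/-- The prefactor `c` makes the Fourier weight `exp(-x² / (4 s c²))` free of any normalization
depending on `c`, so it is pointwise increasing in `c`, while the cosine matrices it multiplies are
positive semidefinite. -/
theorem smul_gaussMatrix_mono {s c d : ℝ} (hs : 0 < s) (hc : 0 < c) (hcd : c ≤ d) (y : ι → ℝ) :
    0 ≤ c • gaussMatrix (s * c ^ 2) y ∧
      c • gaussMatrix (s * c ^ 2) y ≤ d • gaussMatrix (s * d ^ 2) y := by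
  set F : ℝ → ℝ → Matrix ι ι ℝ := fun e x =>
    ((2 * Real.sqrt (Real.pi * s))⁻¹ * Real.exp (-(1 / (4 * s * e ^ 2)) * x ^ 2)) •
      Matrix.of fun a b => Real.cos ((y a - y b) * x) with hF
  have hFab : ∀ e x a b, F e x a b = (2 * Real.sqrt (Real.pi * s))⁻¹ *
      (Real.exp (-(1 / (4 * s * e ^ 2)) * x ^ 2) * Real.cos ((y a - y b) * x)) := by
    intro e x a b
    simp only [hF, Matrix.smul_apply, Matrix.of_apply, smul_eq_mul, mul_assoc]
  have key : ∀ e : ℝ, 0 < e → e • gaussMatrix (s * e ^ 2) y =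
      Matrix.of fun a b => ∫ x : ℝ, F e x a b := by
    intro e he
    ext a b
    have e1 : Real.pi / (1 / (4 * s * e ^ 2)) = (Real.pi * s) * (2 * e) ^ 2 := by
      field_simp
      ring
    have e2 : -(y a - y b) ^ 2 / (4 * (1 / (4 * s * e ^ 2))) = -(s * e ^ 2) * (y a - y b) ^ 2 := by
      field_simp
    simp only [Matrix.smul_apply, gaussMatrix, Matrix.of_apply, smul_eq_mul, hFab]
    rw [integral_const_mul, integral_exp_mul_cos (by positivity), e1, e2,
      Real.sqrt_mul (by positivity) ((2 * e) ^ 2), Real.sqrt_sq (by positivity)]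
    have : Real.sqrt (Real.pi * s) ≠ 0 := by positivity
    field_simp
  have hint : ∀ e : ℝ, 0 < e → ∀ a b : ι, Integrable fun x : ℝ => F e x a b := by
    intro e he a b
    simp only [hFab]
    exact (integrable_exp_mul_cos (by positivity) _).const_mul _
  have hd := hc.trans_le hcd
  rw [key c hc, key d hd]
  constructor
  · have h := integral_mono_loewner (m := volume) (F := fun _ : ℝ => (0 : Matrix ι ι ℝ)) (G := F c)
      (by simp) (hint c hc)
      (.of_forall fun x => smul_nonneg (by positivity) (cosMatrix_nonneg y x))
    refine le_of_eq_of_le ?_ h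
    ext a b
    simp
  · refine integral_mono_loewner (hint c hc) (hint d hd) (.of_forall fun x => ?_)
    refine smul_le_smul_of_nonneg_right ?_ (cosMatrix_nonneg y x)
    gcongr

end Gaussian

/-! ### The Matérn profile as a Gamma mixture of Gaussians. -/

section Mixture

theorem integrableOn_gamma_mul {ν : ℝ} (hν : 0 < ν) {φ : ℝ → ℝ} (hm : Measurable φ) {C : ℝ}
    (hφ : ∀ u, 0 < u → |φ u| ≤ C) :
    IntegrableOn (fun u => Real.exp (-u) * u ^ (ν - 1) * φ u) (Ioi 0) := by
  refine (Real.GammaIntegral_convergent hν).mul_bdd (c := C) hm.aestronglyMeasurable ?_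
  filter_upwards [ae_restrict_mem measurableSet_Ioi] with u hu
  exact hφ u hu

theorem abs_exp_neg_div_le {c u : ℝ} (hc : 0 ≤ c) (hu : 0 < u) : |Real.exp (-(c / u))| ≤ 1 := by
  rw [abs_of_pos (Real.exp_pos _), Real.exp_le_one_iff]
  have : 0 ≤ c / u := by positivity
  linarith

theorem integrableOn_gamma_mul_exp_neg_div {ν c : ℝ} (hν : 0 < ν) (hc : 0 ≤ c) :
    IntegrableOn (fun u => Real.exp (-u) * u ^ (ν - 1) * Real.exp (-(c / u))) (Ioi 0) :=
  integrableOn_gamma_mul hν (by fun_prop) fun _ hu => abs_exp_neg_div_le hc hu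

/-- The substitution `u = (z / 2) exp t` turns `u + z² / (4 u)` into `z cosh t`. -/
theorem integral_gamma_mul_exp_neg_div_eq_besselK {ν z : ℝ} (hν : 0 < ν) (hz : 0 < z) :
    ∫ u in Ioi (0 : ℝ), Real.exp (-u) * u ^ (ν - 1) * Real.exp (-((z ^ 2 / 4) / u)) =
      2 * (z / 2) ^ ν * besselK ν z := by
  set g : ℝ → ℝ := fun u => Real.exp (-u) * u ^ (ν - 1) * Real.exp (-((z ^ 2 / 4) / u)) with hg
  set f : ℝ → ℝ := fun t => z / 2 * Real.exp t with hf
  have hz2 : 0 < z / 2 := by positivity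
  have himage : f '' univ = Ioi 0 := by
    ext u
    simp only [image_univ, mem_range, mem_Ioi, hf]
    constructor
    · rintro ⟨t, rfl⟩
      positivity
    · intro hu
      refine ⟨Real.log (u / (z / 2)), ?_⟩
      rw [Real.exp_log (by positivity)]
      field_simp
  have hderiv : ∀ t ∈ univ, HasDerivWithinAt f (f t) univ t := fun t _ =>
    ((Real.hasDerivAt_exp t).const_mul _).hasDerivWithinAt
  have hinj : InjOn f univ := fun s _ t _ h => by
    have : Real.exp s = Real.exp t := mul_left_cancel₀ hz2.ne' h
    exact Real.exp_injective this
  have hpt : ∀ t, |f t| • g (f t) =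
      (z / 2) ^ ν * (Real.exp (ν * t) * Real.exp (-z * Real.cosh t)) := by
    intro t
    have hft : 0 < f t := by positivity
    have e1 : f t * f t ^ (ν - 1) = (z / 2) ^ ν * Real.exp (ν * t) := by
      rw [← Real.rpow_one_add' hft.le (by linarith [hν]), add_sub_cancel, hf]
      simp only
      rw [Real.mul_rpow hz2.le (Real.exp_pos t).le, ← Real.exp_mul, mul_comm t]
    have e2 : Real.exp (-f t) * Real.exp (-((z ^ 2 / 4) / f t)) =
        Real.exp (-z * Real.cosh t) := by
      rw [← Real.exp_add, Real.cosh_eq, Real.exp_neg t, hf]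
      congr 1
      have := Real.exp_pos t
      field_simp
      ring
    rw [abs_of_pos hft, smul_eq_mul, hg, ← e2]
    simp only
    linear_combination (Real.exp (-f t) * Real.exp (-((z ^ 2 / 4) / f t))) * e1
  have hint : Integrable fun t => Real.exp (ν * t) * Real.exp (-z * Real.cosh t) := by
    have h := integrableOn_gamma_mul_exp_neg_div (c := z ^ 2 / 4) hν (by positivity)
    rw [← himage, integrableOn_image_iff_integrableOn_abs_deriv_smul MeasurableSet.univ hderiv hinj]
      at h
    have h2 := (integrableOn_univ.mp h).const_mul ((z / 2) ^ ν)⁻¹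
    refine h2.congr (.of_forall fun t => ?_)
    have : (z / 2) ^ ν ≠ 0 := by positivity
    have h3 := hpt t
    rw [hg] at h3
    simp only at h3 ⊢
    rw [h3]
    field_simp
  have hint' : Integrable fun t => Real.exp (ν * -t) * Real.exp (-z * Real.cosh (-t)) :=
    hint.comp_neg
  rw [← himage, integral_image_eq_integral_abs_deriv_smul MeasurableSet.univ hderiv hinj,
    setIntegral_univ]
  refine (integral_congr_ae (.of_forall hpt)).trans ?_
  rw [integral_const_mul]
  -- Averaging with `t ↦ -t` keeps the even part of `exp (ν t)`; folding onto the half-line then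
  -- gives the factor `2`.
  have hsymm : ∫ t, Real.exp (ν * t) * Real.exp (-z * Real.cosh t) =
      ∫ t, Real.exp (-z * Real.cosh t) * Real.cosh (ν * t) := by
    have h1 := integral_neg_eq_self (fun t => Real.exp (ν * t) * Real.exp (-z * Real.cosh t)) volume
    have h2 : ∫ t, Real.exp (-z * Real.cosh t) * Real.cosh (ν * t) =
        ∫ t, (1 / 2) * ((Real.exp (ν * t) * Real.exp (-z * Real.cosh t)) +
          (Real.exp (ν * -t) * Real.exp (-z * Real.cosh (-t)))) := by
      refine integral_congr_ae (.of_forall fun t => ?_)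
      simp only [Real.cosh_neg, Real.cosh_eq (ν * t), mul_neg]
      ring
    rw [h2, integral_const_mul, integral_add hint hint', h1]
    ring
  have habs := integral_comp_abs (f := fun t => Real.exp (-z * Real.cosh t) * Real.cosh (ν * t))
  have habs' : ∫ t, Real.exp (-z * Real.cosh t) * Real.cosh (ν * t) =
      ∫ t, Real.exp (-z * Real.cosh |t|) * Real.cosh (ν * |t|) := by
    refine integral_congr_ae (.of_forall fun t => ?_)
    rcases abs_choice t with h | h <;> simp [h, Real.cosh_neg]
  rw [hsymm, habs', habs, besselK]
  ring

theorem maternProfile_eq_integral {ν d : ℝ} (hν : 0 < ν) (hd : 0 ≤ d) :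
    maternProfile ν d = (Real.Gamma ν)⁻¹ *
      ∫ u in Ioi (0 : ℝ), Real.exp (-u) * u ^ (ν - 1) * Real.exp (-(ν * d ^ 2 / u)) := by
  have hΓ : Real.Gamma ν ≠ 0 := (Real.Gamma_pos_of_pos hν).ne'
  rcases hd.eq_or_lt' with rfl | hd
  · simp [maternProfile, ← Real.Gamma_eq_integral hν, hΓ]
  have hz : 0 < 2 * Real.sqrt ν * d := by positivity
  have e : ν * d ^ 2 = (2 * Real.sqrt ν * d) ^ 2 / 4 := by
    rw [mul_pow, mul_pow, Real.sq_sqrt hν.le]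
    ring
  rw [e, integral_gamma_mul_exp_neg_div_eq_besselK hν hz, maternProfile, if_neg hd.ne',
    Real.div_rpow hz.le zero_le_two, Real.rpow_sub_one two_ne_zero]
  field_simp

/-- For parameters `x > c / 2`, the inequality `(x / u) exp(-x / u) ≤ 1` bounds the extra factor
produced by differentiation by `2 / c`, uniformly in `u`. -/
theorem differentiableAt_integral_gamma_mul_exp_neg_div {ν c : ℝ} (hν : 0 < ν) (hc : 0 < c) :
    DifferentiableAt ℝ (fun c => ∫ u in Ioi (0 : ℝ),
      Real.exp (-u) * u ^ (ν - 1) * Real.exp (-(c / u))) c := by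
  have hs : Ioi (c / 2) ∈ nhds c := Ioi_mem_nhds (by linarith)
  have h := hasDerivAt_integral_of_dominated_loc_of_deriv_le (𝕜 := ℝ) (μ := volume.restrict (Ioi 0))
    (F := fun c u => Real.exp (-u) * u ^ (ν - 1) * Real.exp (-(c / u)))
    (F' := fun c u => Real.exp (-u) * u ^ (ν - 1) * (Real.exp (-(c / u)) * (-(1 / u))))
    (bound := fun u => Real.exp (-u) * u ^ (ν - 1) * (2 / c)) (x₀ := c) hs
    (.of_forall fun c => Measurable.aestronglyMeasurable (by fun_prop))
    (integrableOn_gamma_mul_exp_neg_div hν hc.le)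
    (Measurable.aestronglyMeasurable (by fun_prop)) ?_
    (integrableOn_gamma_mul hν measurable_const fun u _ => le_rfl) ?_
  · exact h.2.differentiableAt
  · filter_upwards [ae_restrict_mem measurableSet_Ioi] with u hu x hx
    have hu : 0 < u := hu
    have hx : c / 2 < x := hx
    have hx0 : 0 < x := by linarith
    rw [norm_mul, norm_mul, norm_mul, norm_neg, Real.norm_of_nonneg (Real.exp_pos _).le,
      Real.norm_of_nonneg (Real.rpow_nonneg hu.le _), Real.norm_of_nonneg (Real.exp_pos _).le,
      Real.norm_of_nonneg (by positivity)]
    refine mul_le_mul_of_nonneg_left ?_ (by positivity)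
    have h1 : x / u ≤ Real.exp (x / u) := by linarith [Real.add_one_le_exp (x / u)]
    rw [Real.exp_neg, inv_mul_eq_div, div_le_iff₀ (Real.exp_pos _)]
    have h2 : 1 / u ≤ 2 / c * (x / u) := by
      rw [div_mul_div_comm, div_le_div_iff₀ hu (by positivity)]
      nlinarith
    exact h2.trans (mul_le_mul_of_nonneg_left h1 (by positivity))
  · refine .of_forall fun u x _ => ?_
    exact (((hasDerivAt_id x).div_const u).neg.exp).const_mul _

theorem differentiableAt_maternProfile {ν d : ℝ} (hν : 0 < ν) (hd : 0 < d) :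
    DifferentiableAt ℝ (maternProfile ν) d := by
  have h : DifferentiableAt ℝ (fun d => (Real.Gamma ν)⁻¹ * ∫ u in Ioi (0 : ℝ),
      Real.exp (-u) * u ^ (ν - 1) * Real.exp (-(ν * d ^ 2 / u))) d :=
    (DifferentiableAt.comp (g := fun c => ∫ u in Ioi (0 : ℝ),
      Real.exp (-u) * u ^ (ν - 1) * Real.exp (-(c / u))) (f := fun d => ν * d ^ 2) d
      (differentiableAt_integral_gamma_mul_exp_neg_div hν (by positivity)) (by fun_prop)).const_mul _
  refine h.congr_of_eventuallyEq ?_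
  filter_upwards [Ioi_mem_nhds hd] with x hx
  exact maternProfile_eq_integral hν (le_of_lt hx)

end Mixture

/-! ### Matérn matrices: positivity and the two monotonicities in `μ i`. -/

section MaternMatrix

variable {ι κ : Type*}

/-- The Hadamard product over `j ∈ J` of the Gaussian correlation matrices of the points `y j`. -/
noncomputable def gaussProdMatrix (J : Finset κ) (s : ℝ) (y : κ → ι → ℝ) : Matrix ι ι ℝ :=
  Matrix.of fun a b => ∏ j ∈ J, gaussMatrix s (y j) a b

/-- The correlation matrix of the points `x` for the isotropic Matérn kernel in the coordinates
`j ∈ J`, written as a Gamma mixture of Gaussian correlation matrices. -/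
noncomputable def maternMatrix (ν : ℝ) (J : Finset κ) (x : ι → κ → ℝ) (μ : κ → ℝ) :
    Matrix ι ι ℝ :=
  (Real.Gamma ν)⁻¹ • Matrix.of fun a b => ∫ u in Ioi (0 : ℝ),
    ((Real.exp (-u) * u ^ (ν - 1)) • gaussProdMatrix J (ν / u) fun j a => x a j * μ j) a b

theorem gaussMatrix_mul_right (s t : ℝ) (y : ι → ℝ) :
    gaussMatrix s (fun a => y a * t) = gaussMatrix (s * t ^ 2) y := by
  ext a b
  simp only [gaussMatrix, Matrix.of_apply]
  congr 1
  ring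

theorem gaussMatrix_nonneg [Fintype ι] {s : ℝ} (hs : 0 < s) (y : ι → ℝ) : 0 ≤ gaussMatrix s y := by
  simpa using (smul_gaussMatrix_mono hs one_pos le_rfl y).1

theorem gaussProdMatrix_nonneg [Fintype ι] (J : Finset κ) {s : ℝ} (hs : 0 < s) (y : κ → ι → ℝ) :
    0 ≤ gaussProdMatrix J s y :=
  (prod_hadamard_le J (fun j _ => gaussMatrix_nonneg hs (y j)) fun _ _ => le_rfl).1

theorem gaussProdMatrix_diag (J : Finset κ) (s : ℝ) (y : κ → ι → ℝ) (a : ι) :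
    gaussProdMatrix J s y a a = 1 := by
  simp [gaussProdMatrix, gaussMatrix]

theorem gaussProdMatrix_eq_hadamard_erase [DecidableEq κ] {J : Finset κ} {i : κ} (hi : i ∈ J)
    (s : ℝ) (y : κ → ι → ℝ) :
    gaussProdMatrix J s y = gaussMatrix s (y i) ⊙ gaussProdMatrix (J.erase i) s y := by
  ext a b
  simp only [gaussProdMatrix, Matrix.of_apply, hadamard_apply]
  exact (Finset.mul_prod_erase J (fun j => gaussMatrix s (y j) a b) hi).symm

theorem abs_gaussProdMatrix_le_one (J : Finset κ) {s : ℝ} (hs : 0 < s) (y : κ → ι → ℝ) (a b : ι) :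
    |gaussProdMatrix J s y a b| ≤ 1 := by
  simp only [gaussProdMatrix, Matrix.of_apply, Finset.abs_prod]
  refine Finset.prod_le_one (fun j _ => abs_nonneg _) fun j _ => ?_
  simp only [gaussMatrix, Matrix.of_apply]
  rw [abs_of_pos (Real.exp_pos _), Real.exp_le_one_iff]
  nlinarith [sq_nonneg (y j a - y j b)]

theorem measurable_gaussProdMatrix (J : Finset κ) (ν : ℝ) (y : κ → ι → ℝ) (a b : ι) :
    Measurable fun u => gaussProdMatrix J (ν / u) y a b := by
  simp only [gaussProdMatrix, gaussMatrix, Matrix.of_apply]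
  fun_prop

theorem integrableOn_smul_gaussProdMatrix {ν : ℝ} (hν : 0 < ν) (J : Finset κ) (y : κ → ι → ℝ)
    (a b : ι) : IntegrableOn (fun u =>
      ((Real.exp (-u) * u ^ (ν - 1)) • gaussProdMatrix J (ν / u) y) a b) (Ioi 0) := by
  simp only [Matrix.smul_apply, smul_eq_mul]
  exact integrableOn_gamma_mul hν (measurable_gaussProdMatrix J ν y a b)
    fun u hu => abs_gaussProdMatrix_le_one J (by positivity) y a b

theorem inv_Gamma_pos {ν : ℝ} (hν : 0 < ν) : 0 < (Real.Gamma ν)⁻¹ :=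
  inv_pos.mpr (Real.Gamma_pos_of_pos hν)

theorem maternMatrix_nonneg [Fintype ι] {ν : ℝ} (hν : 0 < ν) (J : Finset κ) (x : ι → κ → ℝ)
    (μ : κ → ℝ) : 0 ≤ maternMatrix ν J x μ := by
  refine smul_nonneg (inv_Gamma_pos hν).le ?_
  have h := integral_mono_loewner (m := volume.restrict (Ioi 0))
    (F := fun _ : ℝ => (0 : Matrix ι ι ℝ))
    (G := fun u : ℝ => (Real.exp (-u) * u ^ (ν - 1)) •
      gaussProdMatrix J (ν / u) fun j a => x a j * μ j) (by simp)
    (integrableOn_smul_gaussProdMatrix hν J _) ?_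
  · refine le_of_eq_of_le ?_ h
    ext a b
    simp
  · filter_upwards [ae_restrict_mem measurableSet_Ioi] with u hu
    have hu : 0 < u := hu
    exact smul_nonneg (by positivity) (gaussProdMatrix_nonneg J (by positivity) _)

/-- The Gaussian factor of coordinate `i` alone is positive definite; the others only contribute a
unit diagonal, so their `μ j` may vanish. -/
theorem maternMatrix_posDef {n : ℕ} {ν : ℝ} (hν : 0 < ν) {J : Finset κ} {i : κ} (hi : i ∈ J)
    {x : Fin n → κ → ℝ} (hx : Function.Injective fun a => x a i) {μ : κ → ℝ} (hμ : 0 < μ i) :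
    (maternMatrix ν J x μ).PosDef := by
  classical
  refine Matrix.PosDef.smul ?_ (inv_Gamma_pos hν)
  refine posDef_integral ?_ (integrableOn_smul_gaussProdMatrix hν J _) ?_
  · rw [Ne, Measure.restrict_eq_zero]
    simp
  · filter_upwards [ae_restrict_mem measurableSet_Ioi] with u hu
    have hu : 0 < u := hu
    refine Matrix.PosDef.smul ?_ (show 0 < Real.exp (-u) * u ^ (ν - 1) by positivity)
    rw [gaussProdMatrix_eq_hadamard_erase hi]
    refine posDef_hadamard_of_diag_pos (gaussMatrix_posDef (by positivity) ?_)
      (gaussProdMatrix_nonneg _ (by positivity) _).posSemidef fun a => ?_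
    · exact fun a b hab => hx (mul_right_cancel₀ hμ.ne' hab)
    · rw [gaussProdMatrix_diag]
      exact one_pos

variable [DecidableEq κ]

theorem gaussProdMatrix_erase_update (J : Finset κ) (i : κ) (s t : ℝ) (x : ι → κ → ℝ)
    (μ : κ → ℝ) :
    gaussProdMatrix (J.erase i) s (fun j a => x a j * Function.update μ i t j) =
      gaussProdMatrix (J.erase i) s fun j a => x a j * μ j := by
  ext a b
  simp only [gaussProdMatrix, Matrix.of_apply]
  refine Finset.prod_congr rfl fun j hj => ?_
  simp only [Function.update_of_ne (Finset.ne_of_mem_erase hj)]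

theorem smul_of_integral (c : ℝ) (m : Measure ℝ) (F : ℝ → Matrix ι ι ℝ) :
    c • (Matrix.of fun a b => ∫ u, F u a b ∂m) = Matrix.of fun a b => ∫ u, (c • F u) a b ∂m := by
  ext a b
  simp only [Matrix.smul_apply, Matrix.of_apply, smul_eq_mul, integral_const_mul]

theorem smul_maternMatrix_mono [Fintype ι] {ν : ℝ} (hν : 0 < ν) {J : Finset κ} {i : κ}
    (hi : i ∈ J) (x : ι → κ → ℝ) (μ : κ → ℝ) {c d : ℝ} (hc : 0 < c) (hcd : c ≤ d) :
    c • maternMatrix ν J x (Function.update μ i c) ≤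
      d • maternMatrix ν J x (Function.update μ i d) := by
  unfold maternMatrix
  rw [smul_comm c, smul_comm d]
  refine smul_le_smul_of_nonneg_left ?_ (inv_Gamma_pos hν).le
  rw [smul_of_integral, smul_of_integral]
  refine integral_mono_loewner
    (fun a b => (integrableOn_smul_gaussProdMatrix hν J _ a b).const_mul c)
    (fun a b => (integrableOn_smul_gaussProdMatrix hν J _ a b).const_mul d) ?_
  filter_upwards [ae_restrict_mem measurableSet_Ioi] with u hu
  have hu : 0 < u := hu
  rw [smul_comm c, smul_comm d]
  refine smul_le_smul_of_nonneg_left ?_ (by positivity)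
  simp only [gaussProdMatrix_eq_hadamard_erase hi, gaussProdMatrix_erase_update,
    Function.update_self, gaussMatrix_mul_right, ← smul_hadamard]
  have hνu : 0 < ν / u := by positivity
  obtain ⟨h0, h1⟩ := smul_gaussMatrix_mono hνu hc hcd fun a => x a i
  exact hadamard_le_hadamard h0 h1 (gaussProdMatrix_nonneg _ hνu _) le_rfl

/-- The integrand in `maternMatrix` after the substitution `u = t² v`, divided by
`t ^ (2ν + |J| - 1)`. -/
noncomputable def rescaledIntegrand (ν : ℝ) (J : Finset κ) (i : κ) (x : ι → κ → ℝ) (μ : κ → ℝ)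
    (t v : ℝ) : Matrix ι ι ℝ :=
  (Real.exp (-(t ^ 2 * v)) * v ^ (ν - 1)) • (gaussMatrix (ν / v) (fun a => x a i) ⊙
    Matrix.of fun a b => ∏ j ∈ J.erase i,
      (t⁻¹ • gaussMatrix (ν / v * t⁻¹ ^ 2) fun a => x a j * μ j) a b)

theorem rescaledIntegrand_antitone [Fintype ι] {ν : ℝ} (hν : 0 < ν) (J : Finset κ) (i : κ)
    (x : ι → κ → ℝ) (μ : κ → ℝ) {c d v : ℝ} (hc : 0 < c) (hcd : c ≤ d) (hv : 0 < v) :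
    rescaledIntegrand ν J i x μ d v ≤ rescaledIntegrand ν J i x μ c v := by
  have hd : 0 < d := hc.trans_le hcd
  have hνv : 0 < ν / v := by positivity
  have hinv : d⁻¹ ≤ c⁻¹ := inv_anti₀ hc hcd
  have hP := prod_hadamard_le (J.erase i)
    (fun j _ => (smul_gaussMatrix_mono hνv (inv_pos.mpr hd) hinv fun a => x a j * μ j).1)
    (fun j _ => (smul_gaussMatrix_mono hνv (inv_pos.mpr hd) hinv fun a => x a j * μ j).2)
  have hG := gaussMatrix_nonneg hνv fun a => x a i
  have h0 := (hG.posSemidef.hadamard hP.1.posSemidef).nonneg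
  have h1 := hadamard_le_hadamard hG le_rfl hP.1 hP.2
  refine (smul_le_smul_of_nonneg_right ?_ h0).trans (smul_le_smul_of_nonneg_left h1 (by positivity))
  gcongr

/-- With `u = t² v` the factor of coordinate `i` loses its dependence on `t`. The power `t ^ (2ν)`
comes from `u ^ (ν - 1)`, its leftover `(t ^ 2)⁻¹` will cancel the Jacobian, and `t ^ |J.erase i|`
repays the factors `t⁻¹` attached to the other Gaussians. -/
theorem smul_gaussProdMatrix_sq_mul {ν : ℝ} {J : Finset κ} {i : κ} (hi : i ∈ J)
    (x : ι → κ → ℝ) (μ : κ → ℝ) {t v : ℝ} (ht : 0 < t) (hv : 0 < v) :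
    (Real.exp (-(t ^ 2 * v)) * (t ^ 2 * v) ^ (ν - 1)) • gaussProdMatrix J (ν / (t ^ 2 * v))
        (fun j a => x a j * Function.update μ i t j) =
      (t ^ (2 * ν + ((J.erase i).card : ℝ)) * (t ^ 2)⁻¹) • rescaledIntegrand ν J i x μ t v := by
  have e1 : gaussMatrix (ν / (t ^ 2 * v)) (fun a => x a i * t) =
      gaussMatrix (ν / v) fun a => x a i := by
    rw [gaussMatrix_mul_right]
    congr 1
    field_simp
  have e2 : (t ^ 2 * v) ^ (ν - 1) = t ^ (2 * ν) * (t ^ 2)⁻¹ * v ^ (ν - 1) := by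
    rw [Real.mul_rpow (by positivity) hv.le, Real.rpow_sub_one (by positivity),
      Real.rpow_mul ht.le, Real.rpow_two, div_eq_mul_inv]
  rw [gaussProdMatrix_eq_hadamard_erase hi, gaussProdMatrix_erase_update, Function.update_self, e1,
    e2, rescaledIntegrand, Real.rpow_add ht, Real.rpow_natCast]
  ext a b
  have e3 : ν / (t ^ 2 * v) = ν / v * t⁻¹ ^ 2 := by field_simp
  simp only [Matrix.smul_apply, hadamard_apply, gaussProdMatrix, Matrix.of_apply, smul_eq_mul,
    Finset.prod_mul_distrib, Finset.prod_const, ← e3]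
  have e4 : t ^ (J.erase i).card * t⁻¹ ^ (J.erase i).card = 1 := by
    rw [← mul_pow, mul_inv_cancel₀ ht.ne', one_pow]
  linear_combination (-Real.exp (-(t ^ 2 * v)) * t ^ (2 * ν) * (t ^ 2)⁻¹ * v ^ (ν - 1) *
    gaussMatrix (ν / v) (fun a => x a i) a b *
    ∏ j ∈ J.erase i, gaussMatrix (ν / (t ^ 2 * v)) (fun a => x a j * μ j) a b) * e4

theorem maternMatrix_update_eq {ν : ℝ} {J : Finset κ} {i : κ} (hi : i ∈ J)
    (x : ι → κ → ℝ) (μ : κ → ℝ) {t : ℝ} (ht : 0 < t) :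
    maternMatrix ν J x (Function.update μ i t) =
      t ^ (2 * ν + ((J.erase i).card : ℝ)) • (Real.Gamma ν)⁻¹ •
        Matrix.of fun a b => ∫ v in Ioi (0 : ℝ), rescaledIntegrand ν J i x μ t v a b := by
  rw [smul_comm, maternMatrix]
  congr 1
  ext a b
  have ht2 : 0 < t ^ 2 := by positivity
  have h := integral_comp_mul_left_Ioi' (fun u => ((Real.exp (-u) * u ^ (ν - 1)) •
    gaussProdMatrix J (ν / u) fun j a => x a j * Function.update μ i t j) a b) 0 ht2
  rw [mul_zero] at h
  simp only [Matrix.smul_apply, Matrix.of_apply] at h ⊢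
  rw [← h]
  have e : ∀ v ∈ Ioi (0 : ℝ), (Real.exp (-(t ^ 2 * v)) * (t ^ 2 * v) ^ (ν - 1)) •
      gaussProdMatrix J (ν / (t ^ 2 * v)) (fun j a => x a j * Function.update μ i t j) a b =
      (t ^ (2 * ν + ((J.erase i).card : ℝ)) * (t ^ 2)⁻¹) * rescaledIntegrand ν J i x μ t v a b :=
    fun v hv => congrFun (congrFun (smul_gaussProdMatrix_sq_mul hi x μ ht hv) a) b
  rw [setIntegral_congr_fun measurableSet_Ioi e, integral_const_mul, smul_eq_mul, smul_eq_mul]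
  field_simp

theorem integrableOn_rescaledIntegrand {ν : ℝ} (hν : 0 < ν) {J : Finset κ} {i : κ} (hi : i ∈ J)
    (x : ι → κ → ℝ) (μ : κ → ℝ) {t : ℝ} (ht : 0 < t) (a b : ι) :
    IntegrableOn (fun v => rescaledIntegrand ν J i x μ t v a b) (Ioi 0) := by
  have ht2 : 0 < t ^ 2 := by positivity
  have h := integrableOn_smul_gaussProdMatrix hν J
    (fun j a => x a j * Function.update μ i t j) a b
  have h2 := (integrableOn_Ioi_comp_mul_left_iff (fun u => ((Real.exp (-u) * u ^ (ν - 1)) •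
    gaussProdMatrix J (ν / u) fun j a => x a j * Function.update μ i t j) a b) 0 ht2).mpr
    (by simpa using h)
  have hk : t ^ (2 * ν + ((J.erase i).card : ℝ)) * (t ^ 2)⁻¹ ≠ 0 := by positivity
  refine IntegrableOn.congr_fun (h2.const_mul (t ^ (2 * ν + ((J.erase i).card : ℝ)) * (t ^ 2)⁻¹)⁻¹)
    (fun v hv => ?_) measurableSet_Ioi
  have e := congrFun (congrFun (smul_gaussProdMatrix_sq_mul (ν := ν) hi x μ ht hv) a) b
  exact (congrArg _ e).trans (inv_mul_cancel_left₀ hk _)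

theorem rpow_smul_maternMatrix_antitone [Fintype ι] {ν : ℝ} (hν : 0 < ν) {J : Finset κ} {i : κ}
    (hi : i ∈ J) (x : ι → κ → ℝ) (μ : κ → ℝ) {c d : ℝ} (hc : 0 < c) (hcd : c ≤ d) :
    d ^ (-(2 * ν + ((J.erase i).card : ℝ))) • maternMatrix ν J x (Function.update μ i d) ≤
      c ^ (-(2 * ν + ((J.erase i).card : ℝ))) • maternMatrix ν J x (Function.update μ i c) := by
  have hd : 0 < d := hc.trans_le hcd
  have key : ∀ t : ℝ, 0 < t →
      t ^ (-(2 * ν + ((J.erase i).card : ℝ))) • maternMatrix ν J x (Function.update μ i t) =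
      (Real.Gamma ν)⁻¹ •
        Matrix.of fun a b => ∫ v in Ioi (0 : ℝ), rescaledIntegrand ν J i x μ t v a b := by
    intro t ht
    rw [maternMatrix_update_eq hi x μ ht, smul_smul, ← Real.rpow_add ht, neg_add_cancel,
      Real.rpow_zero, one_smul]
  rw [key c hc, key d hd]
  refine smul_le_smul_of_nonneg_left ?_ (inv_Gamma_pos hν).le
  refine integral_mono_loewner (integrableOn_rescaledIntegrand hν hi x μ hd)
    (integrableOn_rescaledIntegrand hν hi x μ hc) ?_
  filter_upwards [ae_restrict_mem measurableSet_Ioi] with v hv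
  exact rescaledIntegrand_antitone hν J i x μ hc hcd hv

omit [DecidableEq κ] in
-- Leaving `d` free serves both kernels: the Euclidean norm when `J` is everything, an absolute
-- value when `J` is a singleton.
theorem maternMatrix_apply {ν : ℝ} (hν : 0 < ν) (J : Finset κ) (x : ι → κ → ℝ) (μ : κ → ℝ)
    (a b : ι) {d : ℝ} (hd : 0 ≤ d) (h : d ^ 2 = ∑ j ∈ J, (x a j * μ j - x b j * μ j) ^ 2) :
    maternMatrix ν J x μ a b = maternProfile ν d := by
  rw [maternProfile_eq_integral hν hd, maternMatrix, Matrix.smul_apply, smul_eq_mul]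
  congr 1
  refine setIntegral_congr_fun measurableSet_Ioi fun u _ => ?_
  simp only [Matrix.smul_apply, smul_eq_mul, gaussProdMatrix, gaussMatrix, Matrix.of_apply]
  rw [← Real.exp_sum, ← Finset.mul_sum, h]
  congr 2
  ring

end MaternMatrix

/-! ### Traces and the spread of eigenvalues. -/

section Trace

variable {ι : Type*} [Fintype ι]

theorem trace_sq_eq_sum_eigenvalues_sq [DecidableEq ι] {N : Matrix ι ι ℝ} (hN : N.IsHermitian) :
    (N ^ 2).trace = ∑ k, hN.eigenvalues k ^ 2 := by
  conv_lhs => rw [hN.spectral_theorem, ← map_pow, Unitary.conjStarAlgAut_apply, trace_mul_cycle,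
    Unitary.coe_star_mul_self, one_mul, diagonal_pow, trace_diagonal]
  simp

theorem sum_sq_sub_sq_sum_nonneg [Nonempty ι] (f : ι → ℝ) :
    0 ≤ ∑ k, f k ^ 2 - 1 / (Fintype.card ι : ℝ) * (∑ k, f k) ^ 2 := by
  have h := sq_sum_le_card_mul_sum_sq (s := Finset.univ) (f := f)
  have hm : (0 : ℝ) < Fintype.card ι := by exact_mod_cast Fintype.card_pos
  rw [Finset.card_univ] at h
  rw [sub_nonneg, one_div, inv_mul_le_iff₀ hm]
  exact h

/-- The sum of squared deviations is smallest around the mean, so deviations from `l` bound it. -/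
theorem sum_sq_sub_sq_sum_le [Nonempty ι] {f : ι → ℝ} {l u : ℝ} (hl : ∀ k, l ≤ f k)
    (hu : ∀ k, f k ≤ u) :
    ∑ k, f k ^ 2 - 1 / (Fintype.card ι : ℝ) * (∑ k, f k) ^ 2 ≤ Fintype.card ι * (u - l) ^ 2 := by
  have hm : (0 : ℝ) < Fintype.card ι := by exact_mod_cast Fintype.card_pos
  have h1 : ∑ k, (f k - l) ^ 2 ≤ Fintype.card ι * (u - l) ^ 2 := by
    have : ∀ k ∈ Finset.univ, (f k - l) ^ 2 ≤ (u - l) ^ 2 := fun k _ =>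
      pow_le_pow_left₀ (by linarith [hl k]) (by linarith [hu k]) 2
    simpa using Finset.sum_le_sum this
  have h2 : ∑ k, (f k - l) ^ 2 =
      ∑ k, f k ^ 2 - 2 * l * ∑ k, f k + Fintype.card ι * l ^ 2 := by
    rw [Finset.mul_sum, ← Finset.sum_sub_distrib]
    have : (Fintype.card ι : ℝ) * l ^ 2 = ∑ _k : ι, l ^ 2 := by simp
    rw [this, ← Finset.sum_add_distrib]
    exact Finset.sum_congr rfl fun k _ => by ring
  have h3 : 0 ≤ 1 / (Fintype.card ι : ℝ) * (∑ k, f k - Fintype.card ι * l) ^ 2 := by positivity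
  have h4 : 1 / (Fintype.card ι : ℝ) * (∑ k, f k - Fintype.card ι * l) ^ 2 =
      1 / (Fintype.card ι : ℝ) * (∑ k, f k) ^ 2 - 2 * l * ∑ k, f k + Fintype.card ι * l ^ 2 := by
    field_simp
    ring
  linarith

/-- With `T = S^(-1/2)`, `A * S⁻¹` has the same traces of powers as the symmetric `T * A * T`, and
congruence by `T` turns the hypotheses into bounds `l`, `u` on its spectrum. -/
theorem trace_mul_inv_bounds [DecidableEq ι] [Nonempty ι] {S A : Matrix ι ι ℝ} (hS : S.PosDef)
    {l u : ℝ} (hl : l • S ≤ A) (hu : A ≤ u • S) :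
    0 ≤ ((A * S⁻¹) ^ 2).trace - 1 / (Fintype.card ι : ℝ) * (A * S⁻¹).trace ^ 2 ∧
    ((A * S⁻¹) ^ 2).trace - 1 / (Fintype.card ι : ℝ) * (A * S⁻¹).trace ^ 2 ≤
      Fintype.card ι * (u - l) ^ 2 := by
  set T := CFC.sqrt S⁻¹ with hT
  have hTT : T * T = S⁻¹ := CFC.sqrt_mul_sqrt_self _ hS.inv.posSemidef.nonneg
  have hTh : Tᴴ = T := (CFC.sqrt_nonneg S⁻¹).posSemidef.1
  have hTST : T * S * T = 1 := by
    have hdet : IsUnit S.det := (isUnit_iff_isUnit_det S).mp hS.isUnit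
    rw [mul_assoc, mul_eq_one_comm, mul_assoc, hTT, mul_nonsing_inv S hdet]
  -- Symmetry of `A` is already contained in `A ≤ u • S`.
  have hA : A.IsHermitian := by
    have h := (hS.isHermitian.smul (k := u) (.all _)).sub (show (u • S - A).PosSemidef from hu).1
    rwa [sub_sub_cancel] at h
  have hN : (T * A * T).IsHermitian := by
    have := isHermitian_conjTranspose_mul_mul T hA
    rwa [hTh] at this
  have hconj : ∀ {X Y : Matrix ι ι ℝ}, X ≤ Y → T * X * T ≤ T * Y * T := by
    intro X Y h
    have := (show (Y - X).PosSemidef from h).conjTranspose_mul_mul_same T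
    rw [hTh, mul_sub, sub_mul] at this
    exact this
  have hNl : algebraMap ℝ (Matrix ι ι ℝ) l ≤ T * A * T := by
    have h := hconj hl
    rwa [Matrix.mul_smul, Matrix.smul_mul, hTST, ← Algebra.algebraMap_eq_smul_one] at h
  have hNu : T * A * T ≤ algebraMap ℝ (Matrix ι ι ℝ) u := by
    have h := hconj hu
    rwa [Matrix.mul_smul, Matrix.smul_mul, hTST, ← Algebra.algebraMap_eq_smul_one] at h
  have hspec : ∀ k, hN.eigenvalues k ∈ spectrum ℝ (T * A * T) := fun k => by
    rw [hN.spectrum_real_eq_range_eigenvalues]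
    exact mem_range_self k
  have hkl := fun k => (algebraMap_le_iff_le_spectrum (a := T * A * T) hN).mp hNl _ (hspec k)
  have hku := fun k => (le_algebraMap_iff_spectrum_le (a := T * A * T) hN).mp hNu _ (hspec k)
  have htr : (A * S⁻¹).trace = ∑ k, hN.eigenvalues k := by
    rw [← hTT, ← mul_assoc, trace_mul_comm, ← mul_assoc]
    exact hN.trace_eq_sum_eigenvalues
  have htr2 : ((A * S⁻¹) ^ 2).trace = ∑ k, hN.eigenvalues k ^ 2 := by
    rw [← trace_sq_eq_sum_eigenvalues_sq hN, sq, sq, ← hTT]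
    simp only [mul_assoc]
    rw [trace_mul_comm T]
    simp only [mul_assoc]
  rw [htr, htr2]
  exact ⟨sum_sq_sub_sq_sum_nonneg _, sum_sq_sub_sq_sum_le hkl hku⟩

end Trace

/-! ### From Loewner monotonicity to bounds on the derivative. -/

section Derivative

variable {ι : Type*} [Fintype ι]

theorem deriv_nonneg_of_loewner_mono {F : ℝ → Matrix ι ι ℝ} {F' : Matrix ι ι ℝ} {t : ℝ}
    (ht : 0 < t) (hF : ∀ c, 0 < c → (F c).IsHermitian)
    (hmono : ∀ c d, 0 < c → c ≤ d → F c ≤ F d)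
    (hderiv : ∀ a b, HasDerivAt (fun c => F c a b) (F' a b) t) : 0 ≤ F' := by
  rw [Matrix.nonneg_iff_posSemidef]
  refine Matrix.PosSemidef.of_dotProduct_mulVec_nonneg ?_ fun w => ?_
  · ext a b
    simp only [conjTranspose_apply, star_trivial]
    refine ((hderiv b a).congr_of_eventuallyEq ?_).unique (hderiv a b)
    filter_upwards [Ioi_mem_nhds ht] with c hc
    simpa using (hF c hc).apply b a
  · rw [dotProduct_mulVec_eq_sum]
    have h : HasDerivAt (fun c => ∑ a, ∑ b, w a * (F c a b * w b))
        (∑ a, ∑ b, w a * (F' a b * w b)) t :=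
      HasDerivAt.fun_sum fun a _ => HasDerivAt.fun_sum fun b _ =>
        ((hderiv a b).mul_const _).const_mul _
    have hm : MonotoneOn (fun c => ∑ a, ∑ b, w a * (F c a b * w b)) (Ioi 0) := by
      intro c hc d _ hcd
      have h0 := (show (F d - F c).PosSemidef from hmono c d hc hcd).dotProduct_mulVec_nonneg w
      rw [sub_mulVec, dotProduct_sub, sub_nonneg] at h0
      simpa only [dotProduct_mulVec_eq_sum] using h0
    have h1 := hm.derivWithin_nonneg (x := t)
    rwa [h.hasDerivWithinAt.derivWithin (isOpen_Ioi.uniqueDiffWithinAt ht)] at h1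

/-- The product rule gives `S + t S' ≥ 0` and `S' ≤ (k / t) S`; positivity of `S` allows replacing
`k` by the larger `α`. -/
theorem loewner_deriv_bounds {S : ℝ → Matrix ι ι ℝ} {S' : Matrix ι ι ℝ} {t k α : ℝ} (ht : 0 < t)
    (hS : ∀ c, 0 < c → (S c).PosSemidef)
    (hmono : ∀ c d, 0 < c → c ≤ d → c • S c ≤ d • S d)
    (hanti : ∀ c d, 0 < c → c ≤ d → d ^ (-k) • S d ≤ c ^ (-k) • S c) (hkα : k ≤ α)
    (hderiv : ∀ a b, HasDerivAt (fun c => S c a b) (S' a b) t) :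
    (-t⁻¹) • S t ≤ S' ∧ S' ≤ (α * t⁻¹) • S t := by
  constructor
  · have h := deriv_nonneg_of_loewner_mono (F := fun c => c • S c) (F' := S t + t • S') ht
      (fun c hc => (hS c hc).isHermitian.smul (.all _)) hmono fun a b => by
        have h1 := (hasDerivAt_id t).fun_mul (hderiv a b)
        simpa using! h1
    have h2 := smul_nonneg (inv_nonneg.mpr ht.le) h
    rw [smul_add, smul_smul, inv_mul_cancel₀ ht.ne', one_smul] at h2
    rw [neg_smul]
    exact neg_le_iff_add_nonneg'.mpr h2
  · have h := deriv_nonneg_of_loewner_mono (F := fun c => -(c ^ (-k) • S c))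
      (F' := -((-k * t ^ (-k - 1)) • S t + t ^ (-k) • S')) ht
      (fun c hc => ((hS c hc).isHermitian.smul (.all _)).neg)
      (fun c d hc hcd => neg_le_neg (hanti c d hc hcd)) fun a b => by
        exact ((Real.hasDerivAt_rpow_const (p := -k) (Or.inl ht.ne')).fun_mul (hderiv a b)).fun_neg
    have hpos : 0 < t ^ (-k) := by positivity
    have h2 := smul_nonneg (inv_nonneg.mpr hpos.le) h
    rw [Real.rpow_sub_one ht.ne', smul_neg, smul_add, smul_smul, smul_smul,
      inv_mul_cancel₀ hpos.ne', one_smul,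
      show (t ^ (-k))⁻¹ * (-k * (t ^ (-k) / t)) = -(k * t⁻¹) by field_simp, neg_smul, neg_add,
      neg_neg, ← sub_eq_add_neg, sub_nonneg] at h2
    exact h2.trans (smul_le_smul_of_nonneg_right (by gcongr) (hS t ht).nonneg)

end Derivative

/-! ### Both kernels treated together. -/

section Correlation

theorem norm_scale_sq {r : ℕ} (t : EuclideanSpace ℝ (Fin r)) (μ : Fin r → ℝ) :
    ‖scale t μ‖ ^ 2 = ∑ j, (t j * μ j) ^ 2 := by
  simp [EuclideanSpace.norm_sq_eq, scale, mul_pow]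

theorem maternProfile_zero (ν : ℝ) : maternProfile ν 0 = 1 := if_pos rfl

/-- Diagonal entries are constant, and off the diagonal coordinate `i` keeps the distance positive,
so the profile is never differentiated at `0`. -/
theorem differentiableAt_maternMatrix_update {ι κ : Type*} [DecidableEq κ] {ν : ℝ} (hν : 0 < ν)
    {J : Finset κ} {i : κ} (hi : i ∈ J) {x : ι → κ → ℝ} (hx : Function.Injective fun a => x a i)
    (μ : κ → ℝ) {t : ℝ} (ht : 0 < t) (a b : ι) :
    DifferentiableAt ℝ (fun c => maternMatrix ν J x (Function.update μ i c) a b) t := by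
  set q : ℝ → ℝ := fun c => ∑ j ∈ J,
    (x a j * Function.update μ i c j - x b j * Function.update μ i c j) ^ 2 with hq
  have hq0 : ∀ c, 0 ≤ q c := fun c => Finset.sum_nonneg fun j _ => sq_nonneg _
  have e : ∀ c, maternMatrix ν J x (Function.update μ i c) a b =
      maternProfile ν (Real.sqrt (q c)) := fun c =>
    maternMatrix_apply hν J x _ a b (Real.sqrt_nonneg _) (Real.sq_sqrt (hq0 c))
  simp only [e]
  by_cases hab : a = b
  · have : ∀ c, q c = 0 := fun c => by simp [hq, hab]
    simp only [this]
    exact differentiableAt_const _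
  have hqt : 0 < q t := by
    refine Finset.sum_pos' (fun j _ => sq_nonneg _) ⟨i, hi, ?_⟩
    rw [Function.update_self, ← sub_mul]
    have : x a i - x b i ≠ 0 := sub_ne_zero.mpr fun h => hab (hx h)
    positivity
  have hu : ∀ j, Differentiable ℝ fun c : ℝ => Function.update μ i c j := by
    intro j
    by_cases hj : j = i
    · subst hj
      simp
    · simp [Function.update_of_ne hj]
  have hqd : DifferentiableAt ℝ q t :=
    DifferentiableAt.fun_sum fun j _ => ((((hu j) t).const_mul _).sub (((hu j) t).const_mul _)).pow 2
  exact DifferentiableAt.comp (g := maternProfile ν) (f := fun c => Real.sqrt (q c)) t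
    (differentiableAt_maternProfile hν (Real.sqrt_pos.mpr hqt)) (hqd.sqrt hqt.ne')

/-- Isolates the dependence on `μ i`: the isotropic kernel takes all coordinates and the all-ones
`P`; the tensorized one takes `J = {i}` and puts the other one-dimensional factors in `P`. -/
theorem exists_corrMatrix_update_eq_hadamard {n r : ℕ} {ν : ℝ} (hν : 0 < ν)
    {K : EuclideanSpace ℝ (Fin r) → ℝ} (hK : K = maternIsotropic r ν ∨ K = maternTensorized r ν)
    (x : Fin n → EuclideanSpace ℝ (Fin r)) (i : Fin r) (μ : Fin r → ℝ) :
    ∃ (J : Finset (Fin r)) (P : Matrix (Fin n) (Fin n) ℝ), i ∈ J ∧ 0 ≤ P ∧ (∀ a, P a a = 1) ∧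
      ∀ t, corrMatrix K x (Function.update μ i t) =
        maternMatrix ν J (fun a j => x a j) (Function.update μ i t) ⊙ P := by
  rcases hK with rfl | rfl
  · refine ⟨Finset.univ, Matrix.of fun _ _ => 1, Finset.mem_univ i,
      by simpa using of_mul_self_nonneg (fun _ : Fin n => (1 : ℝ)), by simp, fun t => ?_⟩
    ext a b
    rw [hadamard_apply, Matrix.of_apply, mul_one]
    refine (maternMatrix_apply hν _ _ _ a b (norm_nonneg _) ?_).symm
    rw [norm_scale_sq]
    exact Finset.sum_congr rfl fun j _ => by rw [← sub_mul]; rfl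
  · have hsingle : ∀ (j : Fin r) (η : Fin r → ℝ) (a b : Fin n),
        maternMatrix ν {j} (fun a j => x a j) η a b =
          maternProfile ν |scale (x a - x b) η j| := by
      intro j η a b
      refine maternMatrix_apply hν _ _ _ a b (abs_nonneg _) ?_
      rw [sq_abs, Finset.sum_singleton, ← sub_mul]
      rfl
    refine ⟨{i}, Matrix.of fun a b => ∏ j ∈ Finset.univ.erase i,
      maternMatrix ν {j} (fun a j => x a j) μ a b, Finset.mem_singleton_self i,
      (prod_hadamard_le _ (fun j _ => maternMatrix_nonneg hν {j} _ μ) fun j _ => le_rfl).1,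
      fun a => ?_, fun t => ?_⟩
    · rw [Matrix.of_apply]
      refine Finset.prod_eq_one fun j _ => ?_
      rw [hsingle, sub_self]
      simp [scale, maternProfile_zero]
    · ext a b
      rw [hadamard_apply, Matrix.of_apply, hsingle]
      have h : ∀ j ∈ Finset.univ.erase i, maternMatrix ν {j} (fun a j => x a j) μ a b =
          maternProfile ν |scale (x a - x b) (Function.update μ i t) j| := by
        intro j hj
        rw [hsingle]
        simp [scale, Function.update_of_ne (Finset.ne_of_mem_erase hj)]
      rw [Finset.prod_congr rfl h]
      exact (Finset.mul_prod_erase Finset.univ (fun j =>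
        maternProfile ν |scale (x a - x b) (Function.update μ i t) j|) (Finset.mem_univ i)).symm

theorem mulVec_injective_of_rank_eq {n m : ℕ} {W : Matrix (Fin n) (Fin m) ℝ} (hW : W.rank = m) :
    Function.Injective W.mulVec := by
  have h := LinearMap.finrank_range_add_finrank_ker W.mulVecLin
  rw [Module.finrank_fin_fun] at h
  have h0 : Module.finrank ℝ (LinearMap.ker W.mulVecLin) = 0 := by
    have : Module.finrank ℝ (LinearMap.range W.mulVecLin) = m := hW
    omega
  have h1 := LinearMap.ker_eq_bot.mp (Submodule.finrank_eq_zero.mp h0)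
  exact h1

theorem corrMatrix_loewner_bounds {n r : ℕ} {ν : ℝ} (hν : 0 < ν)
    {K : EuclideanSpace ℝ (Fin r) → ℝ} (hK : K = maternIsotropic r ν ∨ K = maternTensorized r ν)
    {x : Fin n → EuclideanSpace ℝ (Fin r)} (hx : CoordinateDistinct x) (i : Fin r) {μ : Fin r → ℝ}
    (hμi : 0 < μ i) :
    (∀ a b, DifferentiableAt ℝ (fun t => corrMatrix K x (Function.update μ i t) a b) (μ i)) ∧
    (corrMatrix K x μ).PosDef ∧
    (-(μ i)⁻¹) • corrMatrix K x μ ≤ corrMatrixDeriv K x i μ ∧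
    corrMatrixDeriv K x i μ ≤ ((2 * ν + r - 1) * (μ i)⁻¹) • corrMatrix K x μ := by
  obtain ⟨J, P, hi, hP, hPd, hS⟩ := exists_corrMatrix_update_eq_hadamard hν hK x i μ
  have hinj : Function.Injective fun a => x a i := fun a b hab => by
    by_contra hne
    exact hx a b hne i hab
  have hdiff : ∀ a b,
      DifferentiableAt ℝ (fun t => corrMatrix K x (Function.update μ i t) a b) (μ i) := by
    intro a b
    simp only [hS, hadamard_apply]
    exact (differentiableAt_maternMatrix_update hν hi hinj μ hμi a b).mul_const _
  have hpd : ∀ c, 0 < c → (corrMatrix K x (Function.update μ i c)).PosDef := by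
    intro c hc
    rw [hS]
    refine posDef_hadamard_of_diag_pos (maternMatrix_posDef hν hi hinj ?_) hP.posSemidef fun a => ?_
    · rwa [Function.update_self]
    · rw [hPd]
      exact one_pos
  have hself : corrMatrix K x (Function.update μ i (μ i)) = corrMatrix K x μ := by
    rw [Function.update_eq_self]
  -- An equality in the isotropic case; for the tensorized kernel the left side is just `2 * ν`.
  have hcard : 2 * ν + ((J.erase i).card : ℝ) ≤ 2 * ν + r - 1 := by
    have h1 : (J.erase i).card + 1 ≤ r := by
      rw [Finset.card_erase_add_one hi]
      simpa using Finset.card_le_univ J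
    have h2 : ((J.erase i).card : ℝ) + 1 ≤ r := by exact_mod_cast h1
    linarith
  have hM0 := fun c => maternMatrix_nonneg hν J (fun a j => x a j) (Function.update μ i c)
  have hbounds := loewner_deriv_bounds (S := fun c => corrMatrix K x (Function.update μ i c))
    (S' := corrMatrixDeriv K x i μ) hμi (fun c hc => (hpd c hc).posSemidef)
    (fun c d hc hcd => by
      simp only [hS, ← smul_hadamard]
      exact hadamard_le_hadamard (smul_nonneg hc.le (hM0 c))
        (smul_maternMatrix_mono hν hi _ μ hc hcd) hP le_rfl)
    (fun c d hc hcd => by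
      simp only [hS, ← smul_hadamard]
      exact hadamard_le_hadamard (smul_nonneg (Real.rpow_nonneg (hc.trans_le hcd).le _) (hM0 d))
        (rpow_smul_maternMatrix_antitone hν hi _ μ hc hcd) hP le_rfl)
    hcard (fun a b => (hdiff a b).hasDerivAt)
  simp only [hself] at hbounds
  have hpdμ := hpd (μ i) hμi
  rw [hself] at hpdμ
  exact ⟨hdiff, hpdμ, hbounds⟩

end Correlation

end Kriging

/-! ### The bound on the conditional reference prior. -/

theorem mainTheorem10 (r n p : ℕ) (hpn : p < n) (ν : ℝ) (hν : 0 < ν)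
    (K : EuclideanSpace ℝ (Fin r) → ℝ)
    (hK : K = Kriging.maternIsotropic r ν ∨ K = Kriging.maternTensorized r ν)
    (x : Fin n → EuclideanSpace ℝ (Fin r)) (hx : Kriging.CoordinateDistinct x)
    (h : Fin p → EuclideanSpace ℝ (Fin r) → ℝ)
    (hH : (Kriging.regressionMatrix h x).rank = p)
    (W : Matrix (Fin n) (Fin (n - p)) ℝ) (hW : W.rank = n - p)
    (hWH : W.transpose * Kriging.regressionMatrix h x = 0)
    (i : Fin r) (μ : Fin r → ℝ) (hμ : ∀ j, 0 ≤ μ j) (hμi : 0 < μ i) :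
    (∀ a b : Fin n, DifferentiableAt ℝ
      (fun t => Kriging.corrMatrix K x (Function.update μ i t) a b) (μ i)) ∧
    IsUnit (W.transpose * Kriging.corrMatrix K x μ * W).det ∧
    0 ≤ Kriging.priorRadicand K x W i μ ∧
    Kriging.refPrior K x W i μ ≤ ((n : ℝ) - (p : ℝ)) * (2 * ν + (r : ℝ)) * (μ i)⁻¹ := by
  obtain ⟨hdiff, hpd, hlo, hhi⟩ := Kriging.corrMatrix_loewner_bounds hν hK hx i hμi
  have hWt : Wᴴ = W.transpose := conjTranspose_eq_transpose_of_trivial W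
  have hSW : (W.transpose * Kriging.corrMatrix K x μ * W).PosDef := by
    have := hpd.conjTranspose_mul_mul_same (Kriging.mulVec_injective_of_rank_eq hW)
    rwa [hWt] at this
  have hconj : ∀ {X Y : Matrix (Fin n) (Fin n) ℝ}, X ≤ Y →
      W.transpose * X * W ≤ W.transpose * Y * W := by
    intro X Y hXY
    have := (show (Y - X).PosSemidef from hXY).conjTranspose_mul_mul_same W
    rw [hWt, Matrix.mul_sub, Matrix.sub_mul] at this
    exact this
  have hl := hconj hlo
  have hu := hconj hhi
  rw [Matrix.mul_smul, Matrix.smul_mul] at hl hu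
  have : Nonempty (Fin (n - p)) := ⟨⟨0, Nat.sub_pos_of_lt hpn⟩⟩
  have hb := Kriging.trace_mul_inv_bounds hSW hl hu
  rw [Fintype.card_fin] at hb
  refine ⟨hdiff, (isUnit_iff_isUnit_det _).mp hSW.isUnit, hb.1, ?_⟩
  have hm : (1 : ℝ) ≤ ((n - p : ℕ) : ℝ) := by exact_mod_cast Nat.sub_pos_of_lt hpn
  have hnn : 0 ≤ (2 * ν + r) * (μ i)⁻¹ := by positivity
  rw [← Nat.cast_sub hpn.le, mul_assoc]
  refine Real.sqrt_le_iff.mpr ⟨by positivity, hb.2.trans ?_⟩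
  rw [show (2 * ν + r - 1) * (μ i)⁻¹ - -(μ i)⁻¹ = (2 * ν + r) * (μ i)⁻¹ by ring,
    mul_pow ((n - p : ℕ) : ℝ)]
  -- The argument gives the constant `√(n - p)`; it is relaxed to `n - p` using `n - p ≥ 1`.
  exact mul_le_mul_of_nonneg_right (le_self_pow₀ hm two_ne_zero) (sq_nonneg _)
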